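/- Let $\mathcal W = P_{Y|X}$ be a channel with finite non-empty input alphabet $\mathcal X$ and finite output alphabet $\mathcal Y$. All logarithms are binary, with $\log 0=-\infty$. For a distribution $P_X$ on $\mathcal X$ put $P_{XY}(x,y)=P_X(x)P_{Y|X}(y|x)$, and for $\delta\ge 0$ define the smooth min-entropy and the smooth conditional max-entropy $$H^{\delta}_{\min}(X)=\max_{\mathcal E:\Pr(\mathcal E)\ge 1-\delta}\ \min_{x}\bigl(-\log P_{X\mathcal E}(x)\bigr),\qquad H^{\delta}_{\max}(X|Y)=\min_{\mathcal E:\Pr(\mathcal E)\ge 1-\delta}\ \max_{y}\ \log\bigl|\{x: P_{X\mathcal E|Y=y}(x)>0\}\bigr|,$$ where $\mathcal E$ ranges over the events of all probability spaces carrying $X$ (respectively $(X,Y)$), $P_{X\mathcal E}(x)$ is the probability that $X=x$ and $\mathcal E$ occurs, $P_{X\mathcal E|Y=y}(x)$ is the same probability conditioned on $Y=y$, and $y$ ranges over the symbols with $P_Y(y)>0$. (If $\delta\ge1$, the maximum defining $H^\delta_{\min}(X)$ is $+\infty$, and $H^\delta_{\max}(X|Y)=-\infty$.) The $\varepsilon$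 single-serving capacity $C^{\varepsilon}_{\mathrm{comm}}(\mathcal W)$ is the maximum of $\log|\mathcal C|$ over all codes $\mathcal C\subseteq\mathcal X$ for which there is a decoding function $g:\mathcal Y\to\mathcal X$ such that $\Pr[g(Y)\neq x\mid X=x]\le\varepsilon$ for every $x\in\mathcal C$. **Theorem.** For every such channel $\mathcal W$ and all real $\varepsilon',\varepsilon''\ge 0$, $\varepsilon$ with $\varepsilon'+\varepsilon''<\varepsilon\le 1$, $\varepsilon_1>0$ and $\varepsilon_2\ge 0$, the maxima below over all distributions $P_X$ on $\mathcal X$ are attained in $[-\infty,+\infty]$, and $$\max_{P_X}\bigl(H^{\varepsilon'}_{\min}(X)-H^{\varepsilon''}_{\max}(X|Y)\bigr)-\log\frac{4\varepsilon}{(\varepsilon-\varepsilon'-\varepsilon'')^2} \ \le\ C^{\varepsilon}_{\mathrm{comm}}(\mathcal W)\ \le\ \max_{P_X}\bigl(H^{\varepsilon_2}_{\min}(X)-H^{\varepsilon_1+\varepsilon_2+2\varepsilon}_{\max}(X|Y)\bigr)+\log\frac1{\varepsilon_1}.$$ -/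

import Mathlib

namespace SingleServing

/-- Binary logarithm with values in the extended reals and the convention `log 0 = -∞`
(it is only ever applied to nonnegative numbers). -/
noncomputable def log2 (t : ℝ) : EReal :=
  if 0 < t then ((Real.logb 2 t : ℝ) : EReal) else ⊥

/-- A channel `P_{Y|X}` with finite input alphabet `α` and finite output alphabet `β`:
for every input `x` a probability distribution `W x` on `β`. -/
abbrev Channel (α β : Type*) [Fintype β] := α → stdSimplex ℝ β

section

variable {α β : Type*} [Fintype α] [Fintype β]

/-- The joint distribution `P_{XY}(x, y) = P_X(x) P_{Y|X}(y|x)`. -/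
def joint (P : stdSimplex ℝ α) (W : Channel α β) : stdSimplex ℝ (α × β) :=
  ⟨fun z => P.1 z.1 * (W z.1).1 z.2, by
    refine ⟨fun z => mul_nonneg (P.2.1 _) ((W z.1).2.1 _), ?_⟩
    rw [Fintype.sum_prod_type]
    simp only [← Finset.mul_sum, (W _).2.2, mul_one, P.2.2]⟩

/-- The events `𝓔` of probability at least `1 - ε`, each one represented by the function
`z ↦ Pr[Z = z and 𝓔]`, where `Z` is a random variable with distribution `P`. The functions that
arise from an event of a (possibly larger) probability space on which `Z` is defined are exactly
those between `0` and `P`. -/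
def events (ε : ℝ) (P : stdSimplex ℝ α) : Set (α → ℝ) :=
  {E | (∀ z, 0 ≤ E z ∧ E z ≤ P.1 z) ∧ 1 - ε ≤ ∑ z, E z}

/-- Smooth min-entropy `H_min^ε(X) = max_𝓔 min_x (- log P_{X𝓔}(x))`. -/
noncomputable def smoothHmin (ε : ℝ) (P : stdSimplex ℝ α) : EReal :=
  ⨆ E ∈ events ε P, ⨅ x, -log2 (E x)

/-- Smooth conditional max-entropy
`H_max^ε(X|Y) = min_𝓔 max_y log |{x : P_{X𝓔|Y=y}(x) > 0}|`, where
`P_{X𝓔|Y=y}(x) = P_{XY𝓔}(x, y) / P_Y(y)`. Symbols `y` of probability zero do not contribute: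
for them the set is empty. -/
noncomputable def smoothHmax (ε : ℝ) (P : stdSimplex ℝ (α × β)) : EReal :=
  ⨅ E ∈ events ε P, ⨆ y, log2 (Set.ncard {x : α | 0 < E (x, y) / ∑ x', P.1 (x', y)} : ℝ)

/-- A code (a set of input symbols) can be decoded with error at most `ε` if there is a decoding
function for which every symbol of the code is decoded wrongly with probability at most `ε`. -/
def Decodable (ε : ℝ) (W : Channel α β) (C : Finset α) : Prop :=
  ∃ g : β → α, ∀ x ∈ C, ∑ y, Set.indicator {y | g y ≠ x} (W x).1 y ≤ ε

/-- The `ε` single-serving channel capacity: the maximum of `log |C|` over the codes `C` that can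
be decoded with error at most `ε`. -/
noncomputable def capacity (ε : ℝ) (W : Channel α β) : EReal :=
  ⨆ (C : Finset α) (_ : Decodable ε W C), log2 (C.card : ℝ)

/-- The quantity `H_min^ε(X) - H_max^δ(X|Y)` for input distribution `P_X = P` and
channel `P_{Y|X} = W`. -/
noncomputable def entropyGap (ε δ : ℝ) (W : Channel α β) (P : stdSimplex ℝ α) : EReal :=
  smoothHmin ε P - smoothHmax δ (joint P W)

end

end SingleServing

/-!
The maxima over the input distribution are attained because the entropy difference is a supremum of
`eventHmin E - eventHmax F` over events `E` for `X` and `F` for `(X, Y)`. This function is upper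
semicontinuous, since supports can only grow under small perturbations, and the triples of an input
distribution and two such events form a compact set (`exists_isGreatest_entropyGap`). The same
argument shows that the optimal events exist.

The upper bound comes from the uniform distribution on a decodable code `C`. Its min-entropy is
`log |C|`, and on the event that the decoder is correct, which has probability at least `1 - ε`, the
output determines the input (`log2_card_le_entropyGap`). The term `log (1 / ε₁)` is negative only
if `ε₁ > 1`, and then the max-entropy is `-∞`.

The lower bound is random coding. Take optimal events, let `q` bound the probabilities of the first
one, and let the output `y` list the at most `k` inputs in the support of the second one at `y`. A
codeword drawn from the first event is missing from the list with small probability, and any other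
independent codeword is on the list with probability at most `q k`. With `m` slots and
`d = ε - ε' - ε''`, the sum over the slots of `ε` minus the error bound is at least
`m (d - (m - 1) q k)` for some codebook (`exists_codebook`), which is at least `d² / (4 q k)` for a
suitable `m`. Each slot contributes at most `ε`, so at least `d² / (4 ε q k)` slots have error at
most `ε`; these form the code (`exists_decodable_of_lists`). If `ε < 1` their codewords are
distinct, because a repeated codeword is listed whenever the codeword itself is. For `ε = 1` the
whole alphabet is a code.
-/

namespace SingleServing

/-! ### Random codebooks -/

section Codebook

variable {ι Ω κ : Type*} [Fintype ι] [DecidableEq ι] [Fintype Ω] [Fintype κ]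

/-- Expectation of a product of functions of independent coordinates. -/
lemma sum_prod_weight_mul_prod (w : Ω → ℝ) (h : ι → Ω → ℝ) :
    ∑ c : ι → Ω, (∏ i, w (c i)) * ∏ i, h i (c i) = ∏ i, ∑ x, w x * h i x := by
  rw [Finset.prod_univ_sum, Fintype.piFinset_univ]
  simp only [Finset.prod_mul_distrib]

lemma sum_prod_weight {w : Ω → ℝ} (hw : ∑ x, w x = 1) :
    ∑ c : ι → Ω, ∏ i, w (c i) = 1 := by
  simpa [hw] using sum_prod_weight_mul_prod (ι := ι) w (fun _ _ => 1)

lemma sum_prod_weight_mul_apply {w : Ω → ℝ} (hw : ∑ x, w x = 1) (f : Ω → ℝ) (i : ι) :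
    ∑ c : ι → Ω, (∏ l, w (c l)) * f (c i) = ∑ x, w x * f x := by
  have h := sum_prod_weight_mul_prod w (fun l x => if l = i then f x else 1)
  have h1 : ∀ l, ∑ x, w x * (if l = i then f x else 1)
      = if l = i then ∑ x, w x * f x else 1 := by
    intro l; split_ifs <;> simp [hw]
  simp only [h1] at h
  simpa using h

lemma sum_prod_weight_mul_apply_mul_apply {w : Ω → ℝ} (hw : ∑ x, w x = 1) (u v : Ω → ℝ)
    {i j : ι} (hij : i ≠ j) :
    ∑ c : ι → Ω, (∏ l, w (c l)) * (u (c i) * v (c j))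
      = (∑ x, w x * u x) * ∑ x, w x * v x := by
  have h := sum_prod_weight_mul_prod w
    (fun l x => (if l = i then u x else 1) * (if l = j then v x else 1))
  have h1 : ∀ l, ∑ x, w x * ((if l = i then u x else 1) * (if l = j then v x else 1))
      = (if l = i then ∑ x, w x * u x else 1) * (if l = j then ∑ x, w x * v x else 1) := by
    intro l
    by_cases hi : l = i
    · have hj : l ≠ j := fun h => hij (hi.symm.trans h)
      simp [hi, hij]
    · split_ifs <;> simp [hw]
  simp only [h1, Finset.prod_mul_distrib] at h
  simpa using h

/-- The first moment method for a codebook of independent codewords with distribution `w`: some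
codebook does at least as well as the average one, for a score that charges each codeword with
the interference caused by all the others. -/
lemma exists_codebook {w : Ω → ℝ} (hw0 : ∀ x, 0 ≤ w x) (hw : ∑ x, w x = 1) (f : Ω → ℝ)
    (u v : κ → Ω → ℝ) :
    ∃ c : ι → Ω,
      Fintype.card ι * (∑ x, w x * f x - (Fintype.card ι - 1) *
        ∑ k, (∑ x, w x * u k x) * ∑ x, w x * v k x)
      ≤ ∑ i, (f (c i) - ∑ j ∈ Finset.univ.erase i, ∑ k, u k (c i) * v k (c j)) := by
  have hne : Nonempty Ω := by
    by_contra h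
    rw [not_nonempty_iff] at h
    simp at hw
  obtain ⟨c, hc⟩ := Finite.exists_max
    (fun c : ι → Ω => ∑ i, (f (c i) - ∑ j ∈ Finset.univ.erase i, ∑ k, u k (c i) * v k (c j)))
  refine ⟨c, ?_⟩
  calc _ = ∑ c : ι → Ω, (∏ l, w (c l)) *
        ∑ i, (f (c i) - ∑ j ∈ Finset.univ.erase i, ∑ k, u k (c i) * v k (c j)) := by
        have hi : ∀ i : ι, ∑ c : ι → Ω, (∏ l, w (c l)) *
            (f (c i) - ∑ j ∈ Finset.univ.erase i, ∑ k, u k (c i) * v k (c j))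
            = ∑ x, w x * f x - (Fintype.card ι - 1) *
              ∑ k, (∑ x, w x * u k x) * ∑ x, w x * v k x := by
          intro i
          have hj : ∀ j ∈ Finset.univ.erase i, ∑ c : ι → Ω,
              (∏ l, w (c l)) * ∑ k, u k (c i) * v k (c j)
              = ∑ k, (∑ x, w x * u k x) * ∑ x, w x * v k x := by
            intro j hj
            simp only [Finset.mul_sum (Finset.univ : Finset κ)]
            rw [Finset.sum_comm]
            refine Finset.sum_congr rfl fun k _ => ?_
            exact sum_prod_weight_mul_apply_mul_apply hw _ _ (Finset.ne_of_mem_erase hj).symm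
          simp only [mul_sub, Finset.sum_sub_distrib, sum_prod_weight_mul_apply hw,
            Finset.mul_sum (Finset.univ.erase i)]
          rw [Finset.sum_comm, Finset.sum_congr rfl hj, Finset.sum_const, nsmul_eq_mul,
            Finset.card_erase_of_mem (Finset.mem_univ i), Finset.card_univ,
            Nat.cast_sub (Fintype.card_pos_iff.mpr ⟨i⟩), Nat.cast_one]
        simp only [Finset.mul_sum (Finset.univ : Finset ι)]
        rw [Finset.sum_comm, Finset.sum_congr rfl fun i _ => hi i, Finset.sum_const,
          Finset.card_univ, nsmul_eq_mul]
    _ ≤ ∑ c' : ι → Ω, (∏ l, w (c' l)) *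
        ∑ i, (f (c i) - ∑ j ∈ Finset.univ.erase i, ∑ k, u k (c i) * v k (c j)) :=
        Finset.sum_le_sum fun c' _ =>
          mul_le_mul_of_nonneg_left (hc c') (Finset.prod_nonneg fun _ _ => hw0 _)
    _ = _ := by rw [← Finset.sum_mul, sum_prod_weight hw, one_mul]

end Codebook

/-! ### Construction of a code -/

section Code

variable {α β : Type*} [Fintype β] [DecidableEq α]

/-- The probability that the output does not list the input `x`, where the output `y` lists the
symbols of `S y`. -/
noncomputable def missProb (W : Channel α β) (S : β → Finset α) (x : α) : ℝ :=
  ∑ y, if x ∈ S y then 0 else (W x).1 y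

/-- The probability that the output for the input `x` lists the symbol `x'`. -/
noncomputable def hitProb (W : Channel α β) (S : β → Finset α) (x x' : α) : ℝ :=
  ∑ y, (W x).1 y * if x' ∈ S y then 1 else 0

lemma missProb_add_hitProb_self (W : Channel α β) (S : β → Finset α) (x : α) :
    missProb W S x + hitProb W S x x = 1 := by
  rw [missProb, hitProb, ← Finset.sum_add_distrib]
  refine Eq.trans ?_ (W x).2.2
  refine Finset.sum_congr rfl fun y _ => ?_
  split_ifs
  · rw [mul_one, zero_add]
  · rw [mul_zero, add_zero]

lemma missProb_nonneg (W : Channel α β) (S : β → Finset α) (x : α) : 0 ≤ missProb W S x := by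
  refine Finset.sum_nonneg fun y _ => ?_
  split_ifs
  exacts [le_rfl, (W x).2.1 y]

lemma hitProb_nonneg (W : Channel α β) (S : β → Finset α) (x x' : α) : 0 ≤ hitProb W S x x' := by
  refine Finset.sum_nonneg fun y _ => mul_nonneg ((W x).2.1 y) ?_
  split_ifs <;> norm_num

/-- Decoding to the listed codeword fails only if the sent codeword is not listed or another
codeword is. -/
lemma decodable_of_missProb_add_hitProb_le [Fintype α] [Nonempty α] {ε : ℝ}
    {W : Channel α β} (S : β → Finset α) {C : Finset α}
    (h : ∀ x ∈ C, missProb W S x + ∑ x' ∈ C.erase x, hitProb W S x x' ≤ ε) :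
    Decodable ε W C := by
  refine ⟨fun y => if hy : (C ∩ S y).Nonempty then hy.choose else Classical.arbitrary α,
    fun x hx => le_trans ?_ (h x hx)⟩
  simp only [missProb, hitProb]
  rw [Finset.sum_comm, ← Finset.sum_add_distrib]
  refine Finset.sum_le_sum fun y _ => ?_
  have hW := (W x).2.1 y
  have hnn : ∀ x' ∈ C.erase x, 0 ≤ (W x).1 y * (if x' ∈ S y then 1 else 0 : ℝ) := by
    intro x' _
    split_ifs <;> simp [hW]
  by_cases hxS : x ∈ S y
  · have hne : (C ∩ S y).Nonempty := ⟨x, Finset.mem_inter.mpr ⟨hx, hxS⟩⟩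
    rw [Set.indicator_apply]
    simp only [Set.mem_ofPred_eq, dif_pos hne, if_pos hxS, zero_add]
    split_ifs with hg
    · have hs := Finset.mem_inter.mp hne.choose_spec
      refine le_trans ?_ (Finset.single_le_sum hnn (Finset.mem_erase.mpr ⟨hg, hs.1⟩))
      simp [hs.2]
    · exact Finset.sum_nonneg hnn
  · rw [if_neg hxS]
    exact (Set.indicator_le_self' (fun _ _ => (W x).2.1 _) y).trans
      (le_add_of_nonneg_right (Finset.sum_nonneg hnn))

/-- The number `m` of codewords that nearly maximizes `m (d - (m - 1) l)`. -/
lemma exists_nat_sq_div_le {d l : ℝ} (hd : 0 < d) (hl : 0 < l) :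
    ∃ m : ℕ, d ^ 2 / (4 * l) ≤ m * (d - (m - 1) * l) := by
  refine ⟨⌈d / (2 * l)⌉₊, ?_⟩
  set m : ℝ := (⌈d / (2 * l)⌉₊ : ℝ)
  have h1 : d / (2 * l) ≤ m := Nat.le_ceil _
  have h2 : m < d / (2 * l) + 1 := Nat.ceil_lt_add_one (by positivity)
  obtain ⟨r, hr⟩ : ∃ r, r = d / (2 * l) := ⟨_, rfl⟩
  have hd' : d = 2 * l * r := by rw [hr]; field_simp
  rw [← hr] at h1 h2
  have hr0 : 0 ≤ r := by rw [hr]; positivity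
  rw [hd', div_le_iff₀ (by positivity)]
  have h3 : 0 ≤ (m - r) * (r + 1 - m) := mul_nonneg (by linarith) (by linarith)
  have : r ^ 2 ≤ m * (2 * r - (m - 1)) := by nlinarith
  nlinarith [mul_le_mul_of_nonneg_left this (by positivity : 0 ≤ 4 * l ^ 2)]

/-- Achievability by random coding. The codewords are drawn independently from the
sub-distribution `Q`, which is bounded by `q`; the output `y` lists at most `k` symbols, so that
an independent codeword is listed with probability at most `q k`. -/
lemma exists_decodable_of_lists [Fintype α] [Nonempty α] {ε d q k : ℝ}
    (W : Channel α β) (hε0 : 0 < ε) (hε1 : ε < 1) {Q : α → ℝ}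
    (hQ0 : ∀ x, 0 ≤ Q x) (hQq : ∀ x, Q x ≤ q) (hq : 0 < q) (hQ1 : ∑ x, Q x ≤ 1)
    {S : β → Finset α} (hS : ∀ y, ((S y).card : ℝ) ≤ k) (hk : 0 < k)
    (hd : 0 < d) (hdQ : d ≤ ∑ x, Q x * (ε - missProb W S x)) :
    ∃ C : Finset α, Decodable ε W C ∧ d ^ 2 / (4 * ε * (q * k)) ≤ C.card := by
  obtain ⟨m, hm⟩ := exists_nat_sq_div_le hd (mul_pos hq hk)
  -- With the remaining weight `1 - ∑ x, Q x` a slot of the codebook stays empty.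
  let w : Option α → ℝ := fun o => o.elim (1 - ∑ x, Q x) Q
  let f : Option α → ℝ := fun o => o.elim 0 fun x => ε - missProb W S x
  let u : β → Option α → ℝ := fun y o => o.elim 0 fun x => (W x).1 y
  let v : β → Option α → ℝ := fun y o => o.elim 0 fun x => if x ∈ S y then 1 else 0
  have hw0 : ∀ o, 0 ≤ w o := by
    rintro (_ | x)
    exacts [sub_nonneg.mpr hQ1, hQ0 x]
  have hw1 : ∑ o, w o = 1 := by simp [Fintype.sum_option, w]
  obtain ⟨c, hc⟩ := exists_codebook (ι := Fin m) hw0 hw1 f u v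
  have hf : ∑ o, w o * f o = ∑ x, Q x * (ε - missProb W S x) := by
    simp [Fintype.sum_option, w, f]
  have huv : ∑ y, (∑ o, w o * u y o) * ∑ o, w o * v y o ≤ q * k := by
    have hv : ∀ y, ∑ o, w o * v y o ≤ q * k := by
      intro y
      calc ∑ o, w o * v y o = ∑ x ∈ S y, Q x := by simp [Fintype.sum_option, w, v]
        _ ≤ (S y).card • q := Finset.sum_le_card_nsmul _ _ _ fun x _ => hQq x
        _ ≤ q * k := by
          rw [nsmul_eq_mul, mul_comm]; exact mul_le_mul_of_nonneg_left (hS y) hq.le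
    have hu : ∀ y, 0 ≤ ∑ o, w o * u y o := by
      intro y
      simp only [Fintype.sum_option, w, u, Option.elim, mul_zero, zero_add]
      exact Finset.sum_nonneg fun x _ => mul_nonneg (hQ0 x) ((W x).2.1 y)
    have husum : ∑ y, ∑ o, w o * u y o = ∑ x, Q x := by
      simp only [Fintype.sum_option, w, u, Option.elim, mul_zero, zero_add]
      rw [Finset.sum_comm]
      simp only [← Finset.mul_sum, (W _).2.2, mul_one]
    calc _ ≤ ∑ y, (∑ o, w o * u y o) * (q * k) :=
          Finset.sum_le_sum fun y _ => mul_le_mul_of_nonneg_left (hv y) (hu y)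
      _ = (∑ x, Q x) * (q * k) := by rw [← Finset.sum_mul, husum]
      _ ≤ 1 * (q * k) := mul_le_mul_of_nonneg_right hQ1 (by positivity)
      _ = q * k := one_mul _
  let A : Option α → Option α → ℝ := fun o o' => ∑ y, u y o * v y o'
  have hA : ∀ x x', A (some x) (some x') = hitProb W S x x' := fun x x' => rfl
  have hA0 : ∀ o o', 0 ≤ A o o' := by
    rintro (_ | x) (_ | x')
    · simp [A, u]
    · simp [A, u]
    · simp [A, v]
    · rw [hA]; exact hitProb_nonneg _ _ _ _
  let score : Fin m → ℝ := fun i => f (c i) - ∑ j ∈ Finset.univ.erase i, A (c i) (c j)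
  -- Expurgation: keep the slots whose codeword has error probability at most `ε`.
  let C : Finset α := Finset.univ.filter fun x => ∃ i, c i = some x ∧ 0 ≤ score i
  have hscore : ∀ i x, c i = some x →
      score i = ε - missProb W S x - ∑ j ∈ Finset.univ.erase i, A (some x) (c j) := by
    intro i x hi
    simp only [score, hi]
    rfl
  have hinj : ∀ i j x, c i = some x → c j = some x → 0 ≤ score i → i = j := by
    intro i j x hi hj hs
    by_contra hij
    have h1 : A (some x) (c j) ≤ ∑ j ∈ Finset.univ.erase i, A (some x) (c j) :=
      Finset.single_le_sum (f := fun j => A (some x) (c j)) (fun j _ => hA0 _ _)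
        (Finset.mem_erase.mpr ⟨fun h => hij h.symm, Finset.mem_univ j⟩)
    rw [hj, hA] at h1
    rw [hscore i x hi] at hs
    linarith [missProb_add_hitProb_self W S x]
  refine ⟨C, decodable_of_missProb_add_hitProb_le S fun x hx => ?_, ?_⟩
  · obtain ⟨i, hi, hs⟩ := (Finset.mem_filter.mp hx).2
    rw [hscore i x hi] at hs
    have hslot : ∀ x' ∈ C, ∃ j, c j = some x' := fun x' hx' =>
      let ⟨j, hj, _⟩ := (Finset.mem_filter.mp hx').2
      ⟨j, hj⟩
    have : Nonempty (Fin m) := ⟨i⟩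
    choose! s hsl using hslot
    have : ∑ x' ∈ C.erase x, hitProb W S x x' ≤ ∑ j ∈ Finset.univ.erase i, A (some x) (c j) := by
      have hinjs : Set.InjOn s (C.erase x : Finset α) := by
        intro a ha b hb hab
        have h1 := hsl a (Finset.mem_of_mem_erase ha)
        have h2 := hsl b (Finset.mem_of_mem_erase hb)
        rw [hab, h2] at h1
        exact (Option.some.inj h1).symm
      calc _ = ∑ j ∈ (C.erase x).image s, A (some x) (c j) := by
            rw [Finset.sum_image hinjs]
            refine Finset.sum_congr rfl fun x' hx' => ?_
            rw [hsl x' (Finset.mem_of_mem_erase hx'), hA]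
        _ ≤ _ := by
            refine Finset.sum_le_sum_of_subset_of_nonneg ?_ fun j _ _ => hA0 _ _
            intro j hj
            obtain ⟨x', hx', rfl⟩ := Finset.mem_image.mp hj
            refine Finset.mem_erase.mpr ⟨fun h => ?_, Finset.mem_univ _⟩
            have h1 := hsl x' (Finset.mem_of_mem_erase hx')
            rw [h, hi] at h1
            exact Finset.ne_of_mem_erase hx' (Option.some.inj h1).symm
    linarith
  · have hle : ∀ i, score i ≤ if (∃ x, c i = some x ∧ 0 ≤ score i) then ε else 0 := by
      intro i
      have hsum : 0 ≤ ∑ j ∈ Finset.univ.erase i, A (c i) (c j) :=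
        Finset.sum_nonneg fun _ _ => hA0 _ _
      split_ifs with h
      · obtain ⟨x, hx, _⟩ := h
        have := missProb_nonneg W S x
        rw [hx] at hsum
        rw [hscore i x hx]
        linarith
      · rcases hci : c i with _ | x
        · simp only [score, hci] at hsum ⊢
          simpa [f] using hsum
        · exact (not_le.mp fun h0 => h ⟨x, hci, h0⟩).le
    let G : Finset (Fin m) := Finset.univ.filter fun i => ∃ x, c i = some x ∧ 0 ≤ score i
    have hG : ∑ i, score i ≤ G.card * ε := by
      refine (Finset.sum_le_sum fun i _ => hle i).trans ?_
      rw [← Finset.sum_filter, Finset.sum_const, nsmul_eq_mul]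
    have hGC : G.card ≤ C.card := by
      refine Finset.card_le_card_of_injOn (fun i => (c i).getD (Classical.arbitrary α)) ?_ ?_
      · intro i hi
        obtain ⟨x, hx, hs⟩ := (Finset.mem_filter.mp hi).2
        refine Finset.mem_filter.mpr ⟨Finset.mem_univ _, i, ?_, hs⟩
        simp [hx]
      · intro i hi j hj hij
        obtain ⟨x, hx, hs⟩ := (Finset.mem_filter.mp hi).2
        obtain ⟨x', hx', -⟩ := (Finset.mem_filter.mp hj).2
        simp only [hx, hx', Option.getD_some] at hij
        exact hinj i j x hx (hij ▸ hx') hs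
    have hmain : d ^ 2 / (4 * (q * k)) ≤ ∑ i, score i := by
      refine hm.trans (le_trans ?_ hc)
      rw [Fintype.card_fin, hf]
      rcases Nat.eq_zero_or_pos m with h0 | h0
      · simp [h0]
      · have h1 : (1 : ℝ) ≤ m := by exact_mod_cast h0
        refine mul_le_mul_of_nonneg_left ?_ (by positivity)
        exact sub_le_sub hdQ (mul_le_mul_of_nonneg_left huv (by linarith))
    have hGC' : (G.card : ℝ) ≤ C.card := by exact_mod_cast hGC
    have : d ^ 2 / (4 * ε * (q * k)) = d ^ 2 / (4 * (q * k)) / ε := by field_simp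
    rw [this, div_le_iff₀ hε0]
    exact (hmain.trans hG).trans (mul_le_mul_of_nonneg_right hGC' hε0.le)

end Code

/-! ### Elementary properties of the entropies -/

section Entropy

variable {α β : Type*}

lemma log2_of_pos {t : ℝ} (ht : 0 < t) : log2 t = ((Real.logb 2 t : ℝ) : EReal) := if_pos ht

lemma log2_mono : Monotone log2 := by
  intro s t hst
  by_cases hs : 0 < s
  · rw [log2_of_pos hs, log2_of_pos (hs.trans_le hst)]
    exact EReal.coe_le_coe_iff.mpr (Real.logb_le_logb_of_le one_lt_two hs hst)
  · rw [log2, if_neg hs]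
    exact bot_le

lemma log2_ne_top (t : ℝ) : log2 t ≠ ⊤ := by
  rw [log2]
  split_ifs
  exacts [EReal.coe_ne_top _, bot_ne_top]

lemma log2_zero : log2 0 = ⊥ := if_neg (lt_irrefl 0)

lemma log2_one : log2 1 = 0 := by simp [log2_of_pos one_pos]

lemma lowerSemicontinuous_log2 : LowerSemicontinuous log2 := by
  intro t
  by_cases ht : 0 < t
  · have h : (fun s => ((Real.logb 2 s : ℝ) : EReal)) =ᶠ[nhds t] log2 := by
      filter_upwards [lt_mem_nhds ht] with s hs using (log2_of_pos hs).symm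
    refine ContinuousAt.lowerSemicontinuousAt (ContinuousAt.congr ?_ h)
    exact continuous_coe_real_ereal.continuousAt.comp (Real.continuousAt_logb ht.ne')
  · intro z hz
    rw [log2, if_neg ht] at hz
    exact absurd hz not_lt_bot

/-- The min-entropy `min_x (- log E(x))` of a single event, represented by `E`. -/
noncomputable def eventHmin (E : α → ℝ) : EReal := ⨅ x, -log2 (E x)

/-- The logarithm of the size of the largest section of the support of `E`: the conditional
max-entropy of a single event, represented by `E`. -/
noncomputable def eventHmax (E : α × β → ℝ) : EReal :=
  ⨆ y, log2 (Set.ncard {x : α | 0 < E (x, y)} : ℝ)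

lemma upperSemicontinuous_eventHmin :
    UpperSemicontinuous (eventHmin : (α → ℝ) → EReal) :=
  upperSemicontinuous_iInf fun x =>
    (continuous_neg.comp_lowerSemicontinuous_antitone lowerSemicontinuous_log2
      (fun _ _ h => EReal.neg_le_neg_iff.mpr h)).comp (continuous_apply x)

/-- Positive values stay positive under small perturbations, so the sections of the support can
only grow. -/
lemma lowerSemicontinuous_eventHmax [Finite α] :
    LowerSemicontinuous (eventHmax : (α × β → ℝ) → EReal) := by
  refine lowerSemicontinuous_iSup fun y E z hz => ?_
  have h : ∀ x ∈ {x : α | 0 < E (x, y)}, ∀ᶠ E' in nhds E, 0 < E' (x, y) := fun x hx =>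
    (continuous_apply (x, y)).continuousAt.eventually (lt_mem_nhds hx)
  filter_upwards [(Filter.eventually_all_finite (Set.toFinite _)).mpr h] with E' hE'
  refine hz.trans_le (log2_mono ?_)
  exact_mod_cast Set.ncard_le_ncard hE' (Set.toFinite _)

lemma eventHmax_ne_top [Finite β] (E : α × β → ℝ) : eventHmax E ≠ ⊤ := by
  rcases isEmpty_or_nonempty β with h | h
  · simp [eventHmax]
  · obtain ⟨y, hy⟩ := exists_eq_ciSup_of_finite
      (f := fun y => log2 (Set.ncard {x : α | 0 < E (x, y)} : ℝ))
    rw [eventHmax, ← hy]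
    exact log2_ne_top _

variable [Fintype α] [Fintype β]

lemma self_mem_events {ε : ℝ} (hε : 0 ≤ ε) (P : stdSimplex ℝ α) : P.1 ∈ events ε P :=
  ⟨fun z => ⟨P.2.1 z, le_rfl⟩, by linarith [P.2.2]⟩

lemma zero_mem_events {ε : ℝ} (hε : 1 ≤ ε) (P : stdSimplex ℝ α) : 0 ∈ events ε P :=
  ⟨fun z => ⟨le_rfl, P.2.1 z⟩, by simpa using hε⟩

lemma le_one_of_mem_events {ε : ℝ} {P : stdSimplex ℝ α} {E : α → ℝ} (hE : E ∈ events ε P)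
    (x : α) : E x ≤ 1 :=
  (hE.1 x).2.trans ((Finset.single_le_sum (fun z _ => P.2.1 z) (Finset.mem_univ x)).trans P.2.2.le)

lemma eventHmin_ne_bot {ε : ℝ} {P : stdSimplex ℝ α} {E : α → ℝ} (hE : E ∈ events ε P) :
    eventHmin E ≠ ⊥ := by
  have : (0 : EReal) ≤ eventHmin E := le_iInf fun x => by
    rw [EReal.le_neg, neg_zero, ← log2_one]
    exact log2_mono (le_one_of_mem_events hE x)
  exact fun h => absurd this (by simp [h])

/-- Conditioning on `Y = y` does not change the support; for a symbol `y` of probability zero both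
supports are empty. -/
lemma smoothHmax_eq (ε : ℝ) (P : stdSimplex ℝ (α × β)) :
    smoothHmax ε P = ⨅ E ∈ events ε P, eventHmax E := by
  refine iInf_congr fun E => iInf_congr fun hE => iSup_congr fun y => ?_
  congr 3
  ext x
  refine ⟨fun h => ?_, fun h => ?_⟩
  · refine (hE.1 (x, y)).1.lt_of_ne' fun h0 => ?_
    simp [h0] at h
  · refine div_pos h (h.trans_le ((hE.1 (x, y)).2.trans ?_))
    exact Finset.single_le_sum (f := fun x' => P.1 (x', y)) (fun x' _ => P.2.1 (x', y))
      (Finset.mem_univ x)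

/-! ### Attainment of the extrema -/

lemma continuous_joint_apply (W : Channel α β) (z : α × β) :
    Continuous fun P : stdSimplex ℝ α => (joint P W).1 z :=
  ((continuous_apply z.1).comp continuous_subtype_val).mul continuous_const

/-- If a family of distributions depends continuously on a parameter in a compact space, then the
pairs of a parameter and an event form a compact set. -/
lemma isCompact_setOf_mem_events {T : Type*} [TopologicalSpace T] [CompactSpace T] (ε : ℝ)
    {P : T → stdSimplex ℝ α} (hP : ∀ z, Continuous fun t => (P t).1 z) :
    IsCompact {p : T × (α → ℝ) | p.2 ∈ events ε (P p.1)} := by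
  refine (isCompact_univ.prod (isCompact_univ_pi fun _ : α => isCompact_Icc (a := (0 : ℝ))
    (b := 1))).of_isClosed_subset ?_ ?_
  · have : {p : T × (α → ℝ) | p.2 ∈ events ε (P p.1)}
        = (⋂ z, {p | 0 ≤ p.2 z} ∩ {p | p.2 z ≤ (P p.1).1 z}) ∩ {p | 1 - ε ≤ ∑ z, p.2 z} := by
      ext p
      simp [events]
    rw [this]
    have hz : ∀ z, Continuous fun p : T × (α → ℝ) => p.2 z := fun z =>
      (continuous_apply z).comp continuous_snd
    exact (isClosed_iInter fun z => (isClosed_le continuous_const (hz z)).inter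
      (isClosed_le (hz z) ((hP z).comp continuous_fst))).inter
      (isClosed_le continuous_const (continuous_finsetSum _ fun z _ => hz z))
  · exact fun p hp => ⟨Set.mem_univ _, fun x _ => ⟨(hp.1 x).1, le_one_of_mem_events hp x⟩⟩

lemma isCompact_events (ε : ℝ) (P : stdSimplex ℝ α) : IsCompact (events ε P) := by
  have h := (isCompact_setOf_mem_events (T := Unit) ε (P := fun _ => P)
    fun _ => continuous_const).image continuous_snd
  convert h
  ext E
  simp

lemma exists_smoothHmin_eq {ε : ℝ} (hε : 0 ≤ ε) (P : stdSimplex ℝ α) :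
    ∃ E ∈ events ε P, smoothHmin ε P = eventHmin E := by
  obtain ⟨E, hE, hmax⟩ := upperSemicontinuous_eventHmin.upperSemicontinuousOn (events ε P)
    |>.exists_isMaxOn ⟨_, self_mem_events hε P⟩ (isCompact_events ε P)
  exact ⟨E, hE, le_antisymm (iSup₂_le fun E' hE' => hmax hE') (le_iSup₂_of_le E hE le_rfl)⟩

lemma exists_smoothHmax_eq {ε : ℝ} (hε : 0 ≤ ε) (P : stdSimplex ℝ (α × β)) :
    ∃ E ∈ events ε P, smoothHmax ε P = eventHmax E := by
  obtain ⟨E, hE, hmin⟩ := lowerSemicontinuous_eventHmax.lowerSemicontinuousOn (events ε P)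
    |>.exists_isMinOn ⟨_, self_mem_events hε P⟩ (isCompact_events ε P)
  refine ⟨E, hE, ?_⟩
  rw [smoothHmax_eq]
  exact le_antisymm (iInf₂_le_of_le E hE le_rfl) (le_iInf₂ fun E' hE' => hmin hE')

lemma sub_le_entropyGap {ε δ : ℝ} {W : Channel α β} {P : stdSimplex ℝ α} {E : α → ℝ}
    {F : α × β → ℝ} (hE : E ∈ events ε P) (hF : F ∈ events δ (joint P W)) :
    eventHmin E - eventHmax F ≤ entropyGap ε δ W P := by
  refine EReal.sub_le_sub (le_iSup₂_of_le E hE le_rfl) ?_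
  rw [smoothHmax_eq]
  exact iInf₂_le_of_le F hF le_rfl

lemma exists_entropyGap_eq {ε δ : ℝ} (hε : 0 ≤ ε) (hδ : 0 ≤ δ) (W : Channel α β)
    (P : stdSimplex ℝ α) :
    ∃ E ∈ events ε P, ∃ F ∈ events δ (joint P W),
      entropyGap ε δ W P = eventHmin E - eventHmax F := by
  obtain ⟨E, hE, hE'⟩ := exists_smoothHmin_eq hε P
  obtain ⟨F, hF, hF'⟩ := exists_smoothHmax_eq hδ (joint P W)
  exact ⟨E, hE, F, hF, by rw [entropyGap, hE', hF']⟩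

/-- The maximum of the entropy difference over all input distributions is attained: it is the
maximum of an upper semicontinuous function over the compact set of all triples of an input
distribution and two events. -/
lemma exists_isGreatest_entropyGap [Nonempty α] {ε δ : ℝ} (hε : 0 ≤ ε) (hδ : 0 ≤ δ)
    (W : Channel α β) :
    ∃ P : stdSimplex ℝ α,
      IsGreatest (Set.range fun P : stdSimplex ℝ α => entropyGap ε δ W P) (entropyGap ε δ W P) := by
  classical
  let K : Set ((stdSimplex ℝ α × (α → ℝ)) × (stdSimplex ℝ α × (α × β → ℝ))) :=
    (({p | p.2 ∈ events ε p.1}) ×ˢ ({p | p.2 ∈ events δ (joint p.1 W)})) ∩ {p | p.1.1 = p.2.1}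
  have hK : IsCompact K :=
    ((isCompact_setOf_mem_events ε (P := id) fun z =>
      (continuous_apply z).comp continuous_subtype_val).prod
      (isCompact_setOf_mem_events δ (continuous_joint_apply W))).inter_right
      (isClosed_eq (by fun_prop) (by fun_prop))
  have husc : UpperSemicontinuousOn (fun p => eventHmin p.1.2 + -eventHmax p.2.2) K := by
    refine UpperSemicontinuousOn.add' ?_ ?_ fun p hp => EReal.continuousAt_add
      (.inr ?_) (.inl (eventHmin_ne_bot hp.1.1))
    · exact (upperSemicontinuous_eventHmin.comp (g := fun p :
        (stdSimplex ℝ α × (α → ℝ)) × (stdSimplex ℝ α × (α × β → ℝ)) => p.1.2)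
        (by fun_prop)).upperSemicontinuousOn _
    · exact ((continuous_neg.comp_lowerSemicontinuous_antitone lowerSemicontinuous_eventHmax
        fun _ _ h => EReal.neg_le_neg_iff.mpr h).comp (g := fun p :
        (stdSimplex ℝ α × (α → ℝ)) × (stdSimplex ℝ α × (α × β → ℝ)) => p.2.2)
        (by fun_prop)).upperSemicontinuousOn _
    · simpa using eventHmax_ne_top p.2.2
  obtain ⟨P₀⟩ : Nonempty (stdSimplex ℝ α) := inferInstance
  have hne : ((P₀, P₀.1), (P₀, (joint P₀ W).1)) ∈ K :=
    ⟨⟨self_mem_events hε P₀, self_mem_events hδ (joint P₀ W)⟩, rfl⟩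
  obtain ⟨p, ⟨⟨hp1, hp2⟩, hp3⟩, hmax⟩ := husc.exists_isMaxOn ⟨_, hne⟩ hK
  refine ⟨p.1.1, ⟨p.1.1, rfl⟩, ?_⟩
  rintro _ ⟨P, rfl⟩
  obtain ⟨E, hE, F, hF, hEF⟩ := exists_entropyGap_eq hε hδ W P
  have h1 : eventHmin E + -eventHmax F ≤ eventHmin p.1.2 + -eventHmax p.2.2 :=
    hmax (a := ((P, E), (P, F))) ⟨⟨hE, hF⟩, rfl⟩
  have hp2' : p.2.2 ∈ events δ (joint p.1.1 W) := by
    rw [show p.1.1 = p.2.1 from hp3]; exact hp2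
  exact hEF.le.trans (h1.trans (sub_le_entropyGap hp1 hp2'))

/-! ### The two bounds on the capacity -/

/-- The uniform distribution on a nonempty code. -/
noncomputable def uniformOn [DecidableEq α] (C : Finset α) (hC : C.Nonempty) : stdSimplex ℝ α :=
  ⟨fun x => if x ∈ C then (C.card : ℝ)⁻¹ else 0, fun x => by
    dsimp only
    split_ifs <;> positivity, by
    have : (C.card : ℝ) ≠ 0 := by exact_mod_cast hC.card_pos.ne'
    simp [this]⟩

/-- Converse: for the uniform distribution on a decodable code, the event that the decoder is
correct leaves at most one input for each output. -/
lemma log2_card_le_entropyGap [DecidableEq α] {ε ε₂ δ : ℝ} {W : Channel α β} {C : Finset α}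
    (hC : C.Nonempty) (hdec : Decodable ε W C) (hε₂ : 0 ≤ ε₂) (hδ : ε ≤ δ) :
    log2 (C.card : ℝ) ≤ entropyGap ε₂ δ W (uniformOn C hC) := by
  obtain ⟨g, hg⟩ := hdec
  have hc : (0 : ℝ) < C.card := by exact_mod_cast hC.card_pos
  let P := uniformOn C hC
  have hPx : ∀ x, P.1 x = if x ∈ C then (C.card : ℝ)⁻¹ else 0 := fun _ => rfl
  let F : α × β → ℝ := fun z => if g z.2 = z.1 then (joint P W).1 z else 0
  have hF : F ∈ events δ (joint P W) := by
    refine ⟨fun z => ?_, ?_⟩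
    · have := (joint P W).2.1 z
      simp only [F]
      split_ifs
      exacts [⟨this, le_rfl⟩, ⟨le_rfl, this⟩]
    · have hx : ∀ x, P.1 x * (1 - ε) ≤ ∑ y, F (x, y) := by
        intro x
        have hsplit : ∑ y, F (x, y)
            = P.1 x * (1 - ∑ y, Set.indicator {y | g y ≠ x} (W x).1 y) := by
          rw [← (W x).2.2, ← Finset.sum_sub_distrib, Finset.mul_sum]
          refine Finset.sum_congr rfl fun y _ => ?_
          by_cases h : g y = x <;> simp [F, joint, h]
        rw [hsplit]
        by_cases h : x ∈ C
        · exact mul_le_mul_of_nonneg_left (by linarith [hg x h]) (P.2.1 x)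
        · simp [hPx, h]
      have := Finset.sum_le_sum fun x (_ : x ∈ Finset.univ) => hx x
      rw [← Finset.sum_mul, P.2.2] at this
      rw [Fintype.sum_prod_type]
      linarith
  refine le_trans ?_ (sub_le_entropyGap (self_mem_events hε₂ P) hF)
  have h1 : log2 (C.card : ℝ) ≤ eventHmin P.1 := by
    refine le_iInf fun x => ?_
    rw [EReal.le_neg, log2_of_pos hc, ← EReal.coe_neg, ← Real.logb_inv,
      ← log2_of_pos (inv_pos.mpr hc)]
    refine log2_mono ?_
    rw [hPx]
    split_ifs
    exacts [le_rfl, by positivity]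
  have h2 : eventHmax F ≤ 0 := by
    refine iSup_le fun y => ?_
    rw [← log2_one]
    refine log2_mono ?_
    have : Set.ncard {x : α | 0 < F (x, y)} ≤ 1 := by
      rw [Set.ncard_le_one_iff]
      have : ∀ x, 0 < F (x, y) → g y = x := by
        intro x hx
        by_contra h
        simp [F, h] at hx
      intro a b ha hb
      rw [← this a ha, ← this b hb]
    exact_mod_cast this
  simpa using EReal.sub_le_sub h1 h2

/-- Both entropies of events that are not negligible are bounded by real logarithms: `q` is the
largest value of `E` and `k` the size of the largest section of the support of `F`. -/
lemma exists_sub_le_coe_logb {E : α → ℝ} {F : α × β → ℝ} (hE : ∃ x, 0 < E x)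
    (hF : ∃ z, 0 < F z) :
    ∃ q k : ℝ, 0 < q ∧ 1 ≤ k ∧ (∀ x, E x ≤ q) ∧
      (∀ y, (Set.ncard {x : α | 0 < F (x, y)} : ℝ) ≤ k) ∧
      eventHmin E - eventHmax F ≤ ((-Real.logb 2 (q * k) : ℝ) : EReal) := by
  obtain ⟨x₁, hx₁⟩ := hE
  obtain ⟨⟨x₂, y₂⟩, hz⟩ := hF
  have : Nonempty α := ⟨x₁⟩
  have : Nonempty β := ⟨y₂⟩
  obtain ⟨x₀, hx₀⟩ := Finite.exists_max E
  obtain ⟨y₀, hy₀⟩ := Finite.exists_max fun y => Set.ncard {x : α | 0 < F (x, y)}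
  have hq : 0 < E x₀ := hx₁.trans_le (hx₀ x₁)
  have hk : 1 ≤ Set.ncard {x : α | 0 < F (x, y₀)} :=
    ((Set.ncard_pos (Set.toFinite _)).mpr ⟨x₂, hz⟩ : 0 < _).trans_le (hy₀ y₂)
  have hk' : (1 : ℝ) ≤ Set.ncard {x : α | 0 < F (x, y₀)} := by exact_mod_cast hk
  refine ⟨E x₀, Set.ncard {x : α | 0 < F (x, y₀)}, hq, hk', hx₀,
    fun y => by exact_mod_cast hy₀ y, ?_⟩
  have h1 : eventHmin E ≤ ((-Real.logb 2 (E x₀) : ℝ) : EReal) := by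
    rw [EReal.coe_neg, ← log2_of_pos hq]
    exact iInf_le _ x₀
  have h2 : ((Real.logb 2 (Set.ncard {x : α | 0 < F (x, y₀)}) : ℝ) : EReal) ≤ eventHmax F := by
    rw [← log2_of_pos (one_pos.trans_le hk')]
    exact le_iSup (fun y => log2 (Set.ncard {x : α | 0 < F (x, y)} : ℝ)) y₀
  refine (EReal.sub_le_sub h1 h2).trans_eq ?_
  rw [← EReal.coe_sub, Real.logb_mul hq.ne' (one_pos.trans_le hk').ne']
  congr 1
  ring

lemma exists_pos_of_mem_events {ε : ℝ} (hε : ε < 1) {P : stdSimplex ℝ α} {E : α → ℝ}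
    (hE : E ∈ events ε P) : ∃ x, 0 < E x := by
  by_contra! h
  linarith [hE.2, Finset.sum_nonpos fun x (_ : x ∈ Finset.univ) => h x]

/-- Achievability: two events of high probability yield a large decodable code. The output `y` lists
the inputs `x` for which `(x, y)` is in the support of the second event. -/
lemma exists_decodable_of_events [Nonempty α] {ε ε' ε'' q k : ℝ} {W : Channel α β}
    {P : stdSimplex ℝ α} (hε' : 0 ≤ ε') (hε'' : 0 ≤ ε'') (hlt : ε' + ε'' < ε) (hε : ε ≤ 1)
    {E : α → ℝ} {F : α × β → ℝ} (hE : E ∈ events ε' P) (hF : F ∈ events ε'' (joint P W))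
    (hq : 0 < q) (hk : 1 ≤ k) (hEq : ∀ x, E x ≤ q)
    (hFk : ∀ y, (Set.ncard {x : α | 0 < F (x, y)} : ℝ) ≤ k) :
    ∃ C : Finset α, Decodable ε W C ∧ (ε - ε' - ε'') ^ 2 / (4 * ε * (q * k)) ≤ C.card := by
  classical
  have hd : 0 < ε - ε' - ε'' := by linarith
  rcases hε.eq_or_lt with rfl | hε1
  · -- Every code is decodable, and the whole alphabet has at least `(1 - ε') / q` symbols.
    refine ⟨Finset.univ, ⟨fun _ => Classical.arbitrary α, fun x _ => ?_⟩, ?_⟩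
    · rw [← (W x).2.2]
      exact Finset.sum_le_sum fun y _ => Set.indicator_le_self' (fun _ _ => (W x).2.1 _) y
    have h1 : 1 - ε' ≤ (Finset.univ : Finset α).card * q := by
      refine hE.2.trans ((Finset.sum_le_card_nsmul _ _ _ fun x _ => hEq x).trans_eq ?_)
      rw [nsmul_eq_mul]
    rw [div_le_iff₀ (by positivity)]
    have h2 : (Finset.univ : Finset α).card * q ≤ (Finset.univ : Finset α).card * q * k :=
      le_mul_of_one_le_right (by positivity) hk
    nlinarith
  · let S : β → Finset α := fun y => Finset.univ.filter fun x => 0 < F (x, y)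
    have hS : ∀ y, ((S y).card : ℝ) ≤ k := by
      intro y
      refine le_trans (le_of_eq ?_) (hFk y)
      rw [← Set.ncard_coe_finset]
      congr 2
      ext x
      simp [S]
    have hmiss : ∑ x, E x * missProb W S x ≤ ε'' := by
      calc ∑ x, E x * missProb W S x ≤ ∑ x, P.1 x * missProb W S x :=
            Finset.sum_le_sum fun x _ =>
              mul_le_mul_of_nonneg_right (hE.1 x).2 (missProb_nonneg W S x)
        _ ≤ ∑ x, ∑ y, ((joint P W).1 (x, y) - F (x, y)) := by
            refine Finset.sum_le_sum fun x _ => ?_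
            rw [missProb, Finset.mul_sum]
            refine Finset.sum_le_sum fun y _ => ?_
            split_ifs with h
            · rw [mul_zero]
              exact sub_nonneg.mpr (hF.1 (x, y)).2
            · have h0 : F (x, y) ≤ 0 := not_lt.mp fun h0 => h (by simp [S, h0])
              have : (joint P W).1 (x, y) = P.1 x * (W x).1 y := rfl
              rw [this]
              linarith
        _ = 1 - ∑ z, F z := by
            rw [← (joint P W).2.2, ← Finset.sum_sub_distrib, Fintype.sum_prod_type]
        _ ≤ ε'' := by linarith [hF.2]
    refine exists_decodable_of_lists W (by linarith) hε1 (fun x => (hE.1 x).1) hEq hq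
      ((Finset.sum_le_sum fun x _ => (hE.1 x).2).trans P.2.2.le) hS (by linarith) hd ?_
    simp only [mul_sub, Finset.sum_sub_distrib, ← Finset.sum_mul]
    have h1 : (1 - ε') * ε ≤ (∑ x, E x) * ε := mul_le_mul_of_nonneg_right hE.2 (by linarith)
    nlinarith

end Entropy

end SingleServing

open SingleServing

theorem mainTheorem1 {α β : Type*} [Fintype α] [Nonempty α] [Fintype β]
    (W : SingleServing.Channel α β)
    (ε ε' ε'' ε₁ ε₂ : ℝ) (hε' : 0 ≤ ε') (hε'' : 0 ≤ ε'') (hlt : ε' + ε'' < ε) (hε : ε ≤ 1)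
    (hε₁ : 0 < ε₁) (hε₂ : 0 ≤ ε₂) :
    ∃ L U : EReal,
      IsGreatest (Set.range fun P : stdSimplex ℝ α => SingleServing.entropyGap ε' ε'' W P) L ∧
      IsGreatest (Set.range fun P : stdSimplex ℝ α =>
        SingleServing.entropyGap ε₂ (ε₁ + ε₂ + 2 * ε) W P) U ∧
      L - ((Real.logb 2 (4 * ε / (ε - ε' - ε'') ^ 2) : ℝ) : EReal)
        ≤ SingleServing.capacity ε W ∧
      SingleServing.capacity ε W ≤ U + ((Real.logb 2 (1 / ε₁) : ℝ) : EReal) := by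
  classical
  have hε0 : 0 < ε := by linarith
  obtain ⟨P, hP⟩ := exists_isGreatest_entropyGap hε' hε'' W
  obtain ⟨P', hP'⟩ := exists_isGreatest_entropyGap hε₂
    (by linarith : 0 ≤ ε₁ + ε₂ + 2 * ε) W
  refine ⟨_, _, hP, hP', ?_, ?_⟩
  · obtain ⟨E, hE, F, hF, hEF⟩ := exists_entropyGap_eq hε' hε'' W P
    obtain ⟨q, k, hq, hk, hEq, hFk, hqk⟩ := exists_sub_le_coe_logb
      (exists_pos_of_mem_events (by linarith) hE) (exists_pos_of_mem_events (by linarith) hF)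
    obtain ⟨C, hC, hcard⟩ := exists_decodable_of_events hε' hε'' hlt hε hE hF hq hk hEq hFk
    have hd : 0 < ε - ε' - ε'' := by linarith
    have hk0 : 0 < k := by linarith
    have hpos : 0 < (ε - ε' - ε'') ^ 2 / (4 * ε * (q * k)) := by positivity
    refine le_trans ?_ (le_iSup₂_of_le C hC (log2_mono hcard))
    rw [hEF, log2_of_pos hpos]
    refine (EReal.sub_le_sub hqk le_rfl).trans_eq ?_
    rw [← EReal.coe_sub, sub_eq_add_neg, ← Real.logb_inv, ← Real.logb_inv,
      ← Real.logb_mul (by positivity) (by positivity)]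
    congr 2
    field_simp
  · refine iSup₂_le fun C hC => ?_
    rcases C.eq_empty_or_nonempty with rfl | hne
    · rw [Finset.card_empty, Nat.cast_zero, log2_zero]
      exact bot_le
    · rcases le_or_gt ε₁ 1 with h1 | h1
      · refine (log2_card_le_entropyGap hne hC hε₂
          (by linarith : ε ≤ ε₁ + ε₂ + 2 * ε)).trans ((hP'.2 ⟨_, rfl⟩).trans ?_)
        refine le_add_of_nonneg_right (EReal.coe_nonneg.mpr ?_)
        exact Real.logb_nonneg one_lt_two ((one_le_div hε₁).mpr h1)
      · -- The impossible event is admitted in the max-entropy, so the bound is `⊤`.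
        have hbot : eventHmax (0 : α × β → ℝ) = ⊥ := by simp [eventHmax, log2_zero]
        have htop := sub_le_entropyGap (self_mem_events hε₂ P')
          (zero_mem_events (by linarith : 1 ≤ ε₁ + ε₂ + 2 * ε) (joint P' W))
        have hbot' := eventHmin_ne_bot (self_mem_events hε₂ P')
        rw [hbot, sub_eq_add_neg, EReal.neg_bot, EReal.add_top_of_ne_bot hbot', top_le_iff] at htop
        rw [htop, EReal.top_add_coe]
        exact le_top
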